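/- Let $n,j$ be integers with $3\le j$ and $j+1\le n$, and let $\mathfrak s_J\in\mathbb C$ be given for the three-element subsets $J=\{a,b,c\}$ of $\{1,\dots,n\}$ such that (momentum conservation) $\sum_{J\ni a}\mathfrak s_J=0$ for every $a=1,\dots,n$, and (split kinematics $(1,2,j,j+1)$) $\mathfrak s_{abc}=0$ unless $\{a,b,c\}\subseteq\{1,\dots,j+1\}$ or $\{a,b,c\}\subseteq\{j,\dots,n,1,2\}$. For an ordering $\alpha=(\alpha_1,\dots,\alpha_m)$ of a set of labels containing $1,2,j,j+1$, fix the punctures $1,2,j,j+1$ to vectors $P_1,P_2,P_j,P_{j+1}\in\mathbb C^3$, write every other puncture as $(x_{1,a},x_{2,a},1)$, and let $|abc|$ be the determinant of the three vectors $a,b,c$. Put $\mathcal S_\alpha=\sum_{\{a,b,c\}\subseteq\alpha,\;a<b<c}\mathfrak s_{abc}\log|abc|$, $\mathrm{PT}_\alpha=\prod_{i=1}^m|\alpha_i\,\alpha_{i+1}\,\alpha_{i+2}|^{-1}$ (indices mod $m$), $V=|1,2,j|\,|2,j,j+1|\,|j,j+1,1|\,|j+1,1,2|$, and define $$\mathcal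 I_\alpha(P)=\int\prod_{a\in\alpha,\;a\notin\{1,2,j,j+1\}}\ \prod_{t=1}^2dx_{t,a}\,\delta\!\left(\frac{\partial\mathcal S_\alpha}{\partial x_{t,a}}\right)(V\,\mathrm{PT}_\alpha)^2:=\sum_{x}\frac{(V\,\mathrm{PT}_\alpha)^2}{\det(\partial^2\mathcal S_\alpha)}\bigg|_{x}.$$ The sum is over the solutions $x$ of the scattering equations $\partial\mathcal S_\alpha/\partial x_{t,a}=0$ at which every bracket occurring in $\mathcal S_\alpha$ (with nonzero coefficient) or in $\mathrm{PT}_\alpha$ is nonzero. Call $\mathcal I_\alpha(P)$ regular if there are finitely many such solutions, all with $\det(\partial^2\mathcal S_\alpha)\ne0$. (In the non-regular case solutions with vanishing Hessian determinant are given the value $0$, and a sum with infinitely many nonzero terms is given the value $0$.) The $k=3$ CEGM amplitude is $m^{(3)}_n(\mathbb I,\mathbb I)=\mathcal I_{(1,\dots,n)}(P)$. Let $P^0$ be the gauge $P^0_1=(0,0,1)$, $P^0_2=(0,1,0)$, $P^0_j=(1,0,0)$, $P^0_{j+1}=(1,1,1)$. Let $P$ be a generic gauge: for some $g\in GL(3,\mathbb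 C)$ each $P_a$ ($a\in\{1,2,j,j+1\}$) is a nonzero multiple of $gP^0_a$, and $g$ (respectively $g^{-1}$) moves no integrated puncture of an $n$-point solution in the gauge $P^0$ (respectively $P$) to the line at infinity (third homogeneous coordinate zero). This holds in particular for $P=P^0$, $g=1$. Then, evaluated at these split kinematics, $$m^{(3)}_n(\mathbb I,\mathbb I)\big|_{(1,2,j,j+1)}=\mathcal I_{(1,2,\dots,n)}(P)=\mathcal I_{(1,2,\dots,j+1)}(P^0)\cdot\mathcal I_{(j,j+1,\dots,n,1,2)}(P^0).$$ Moreover, if the two integrals on the right are regular, then so is $\mathcal I_{(1,\dots,n)}(P)$; conversely, if $\mathcal I_{(1,\dots,n)}(P)$ is regular and its scattering equations have at least one solution, then both integrals on the right are regular. -/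

import Mathlib

open scoped Matrix

noncomputable section

namespace CEGM

/-- The bracket `|u v w|`: the `3 × 3` determinant of three homogeneous coordinate vectors. -/
def bracket (u v w : Fin 3 → ℂ) : ℂ := (Matrix.of ![u, v, w]).det

/-- The Plücker coordinate `|abc|`, `a < b < c`, attached to a three-element set `J = {a, b, c}`
of labels, for the configuration `p` of punctures. -/
def plucker (p : ℕ → Fin 3 → ℂ) (J : Finset ℕ) : ℂ :=
  bracket (p (J.sort.getD 0 0)) (p (J.sort.getD 1 0)) (p (J.sort.getD 2 0))

/-- Momentum conservation: `∑_{J ∋ a} 𝔰_J = 0` for all `a = 1, …, n`, where `J` runs over the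
three-element subsets of `{1, …, n}`. -/
def MomentumConservation (n : ℕ) (s : Finset ℕ → ℂ) : Prop :=
  ∀ a ∈ Finset.Icc 1 n, ∑ J ∈ ((Finset.Icc 1 n).powersetCard 3).filter (fun J => a ∈ J), s J = 0

/-- The split kinematics subspace `(1, 2, j, j + 1)`: `𝔰_{abc} = 0` unless
`a, b, c ∈ {1, …, j + 1}` or `a, b, c ∈ {j, …, n, 1, 2}`. -/
def SplitKinematics (n j : ℕ) (s : Finset ℕ → ℂ) : Prop :=
  ∀ J ∈ (Finset.Icc 1 n).powersetCard 3,
    ¬ J ⊆ Finset.Icc 1 (j + 1) → ¬ J ⊆ Finset.Icc j n ∪ {1, 2} → s J = 0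

/-- The canonical ordering `(1, 2, …, n)`. -/
def fullOrdering (n : ℕ) : List ℕ := List.range' 1 n

/-- The ordering `(1, 2, …, j + 1)`. -/
def leftOrdering (j : ℕ) : List ℕ := List.range' 1 (j + 1)

/-- The ordering `(j, j + 1, …, n, 1, 2)`. -/
def rightOrdering (n j : ℕ) : List ℕ := List.range' j (n + 1 - j) ++ [1, 2]

/-- The labels of the gauge-fixed punctures. -/
def fixedLabels (j : ℕ) : Finset ℕ := {1, 2, j, j + 1}

/-- The labels of the punctures that are integrated over. -/
def freeLabels (j : ℕ) (α : List ℕ) : Finset ℕ := α.toFinset \ fixedLabels j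

/-- Index set of the integration variables `x_{t,a}`, `a` a free label and `t` one of two
inhomogeneous coordinates. -/
abbrev Var (j : ℕ) (α : List ℕ) : Type := ↥(freeLabels j α) × Fin 2

/-- The gauge fixing in which the punctures `1`, `2`, `j`, `j + 1` are
`(0,0,1)`, `(0,1,0)`, `(1,0,0)`, `(1,1,1)`. -/
def stdGauge (j : ℕ) (a : ℕ) : Fin 3 → ℂ :=
  if a = 1 then ![0, 0, 1] else if a = 2 then ![0, 1, 0] else if a = j then ![1, 0, 0]
  else ![1, 1, 1]

/-- The configuration of punctures: a free puncture `a` is `(x_{1,a}, x_{2,a}, 1)`, a gauge-fixed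
puncture `a` has the prescribed homogeneous coordinates `P a`. -/
def puncture (j : ℕ) (α : List ℕ) (P : ℕ → Fin 3 → ℂ) (x : Var j α → ℂ) (a : ℕ) : Fin 3 → ℂ :=
  if h : a ∈ freeLabels j α then ![x (⟨a, h⟩, 0), x (⟨a, h⟩, 1), 1] else P a

/-- The bracket of the three cyclically consecutive labels of `α` starting at position `i`. -/
def consecutive (α : List ℕ) (p : ℕ → Fin 3 → ℂ) (i : ℕ) : ℂ :=
  bracket (p (α.getD (i % α.length) 0)) (p (α.getD ((i + 1) % α.length) 0))
    (p (α.getD ((i + 2) % α.length) 0))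

/-- The `k = 3` Parke–Taylor function of the ordering `α`. -/
def parkeTaylor (α : List ℕ) (p : ℕ → Fin 3 → ℂ) : ℂ :=
  1 / ∏ i ∈ Finset.range α.length, consecutive α p i

/-- The Faddeev–Popov factor `V_{1,2,j,j+1} = |1,2,j| |2,j,j+1| |j,j+1,1| |j+1,1,2|`. -/
def faddeevPopov (j : ℕ) (p : ℕ → Fin 3 → ℂ) : ℂ :=
  bracket (p 1) (p 2) (p j) * bracket (p 2) (p j) (p (j + 1)) *
    bracket (p j) (p (j + 1)) (p 1) * bracket (p (j + 1)) (p 1) (p 2)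

/-- The derivative `∂𝒮/∂x_k` of the potential `𝒮 = ∑_{a<b<c} 𝔰_{abc} log |abc|`, the sum running
over the labels in `α`. It is written with logarithmic derivatives, so that no branch of the
logarithm has to be chosen. -/
def dPotential (j : ℕ) (s : Finset ℕ → ℂ) (α : List ℕ) (P : ℕ → Fin 3 → ℂ)
    (x : Var j α → ℂ) (k : Var j α) : ℂ :=
  ∑ J ∈ α.toFinset.powersetCard 3,
    s J * logDeriv (fun z : ℂ => plucker (puncture j α P (Function.update x k z)) J) (x k)

/-- The Hessian matrix `∂²𝒮/∂x_l∂x_k` of the potential. -/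
def hessian (j : ℕ) (s : Finset ℕ → ℂ) (α : List ℕ) (P : ℕ → Fin 3 → ℂ)
    (x : Var j α → ℂ) : Matrix (Var j α) (Var j α) ℂ :=
  Matrix.of fun k l =>
    deriv (fun z : ℂ => dPotential j s α P (Function.update x l z) k) (x l)

/-- The solutions of the scattering equations `∂𝒮/∂x_k = 0`, among the configurations at which
the potential and the Parke–Taylor function are defined (every bracket that occurs in either of
them is nonzero). -/
def solutions (j : ℕ) (s : Finset ℕ → ℂ) (α : List ℕ) (P : ℕ → Fin 3 → ℂ) :
    Set (Var j α → ℂ) :=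
  {x | (∀ J ∈ α.toFinset.powersetCard 3, s J ≠ 0 → plucker (puncture j α P x) J ≠ 0) ∧
    (∀ i ∈ Finset.range α.length, consecutive α (puncture j α P x) i ≠ 0) ∧
    ∀ k, dPotential j s α P x k = 0}

/-- The delta functions localize on finitely many simple solutions. -/
def IsRegular (j : ℕ) (s : Finset ℕ → ℂ) (α : List ℕ) (P : ℕ → Fin 3 → ℂ) : Prop :=
  (solutions j s α P).Finite ∧ ∀ x ∈ solutions j s α P, (hessian j s α P x).det ≠ 0

/-- The CEGM-type integral
`∫ ∏_{a free} ∏_{t=1,2} dx_{t,a} δ(∂𝒮/∂x_{t,a}) (V_{1,2,j,j+1} PT_α)²`.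
The holomorphic delta functions localize it to the sum of `(V PT_α)² / det(∂²𝒮)` over the
solutions of the scattering equations. -/
def integral (j : ℕ) (s : Finset ℕ → ℂ) (α : List ℕ) (P : ℕ → Fin 3 → ℂ) : ℂ :=
  ∑ᶠ x ∈ solutions j s α P,
    (faddeevPopov j (puncture j α P x) * parkeTaylor α (puncture j α P x)) ^ 2 /
      (hessian j s α P x).det

/-- The `n`-particle amplitude `m_n^{(3)}(𝕀, 𝕀)`, computed with the punctures `1`, `2`, `j`, `j + 1`
fixed to the values `P`. -/
def amplitude (n j : ℕ) (s : Finset ℕ → ℂ) (P : ℕ → Fin 3 → ℂ) : ℂ :=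
  integral j s (fullOrdering n) P

/-- `P` is a generic choice of values for the punctures `1`, `2`, `j`, `j + 1`: it is the image of
the standard one under a projective transformation `g` (that is, the four points are in general
position), and neither of the two gauges moves a puncture of a solution found in the other one to
the line at infinity `x₃ = 0` of the inhomogeneous coordinates. -/
def IsGenericGauge (n j : ℕ) (s : Finset ℕ → ℂ) (g : GL (Fin 3) ℂ) (P : ℕ → Fin 3 → ℂ) : Prop :=
  (∀ a ∈ fixedLabels j, ∃ c : ℂ, c ≠ 0 ∧
      P a = c • ((g : Matrix (Fin 3) (Fin 3) ℂ) *ᵥ stdGauge j a)) ∧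
  (∀ x ∈ solutions j s (fullOrdering n) (stdGauge j), ∀ a ∈ freeLabels j (fullOrdering n),
      ((g : Matrix (Fin 3) (Fin 3) ℂ) *ᵥ puncture j (fullOrdering n) (stdGauge j) x a) 2 ≠ 0) ∧
  (∀ x ∈ solutions j s (fullOrdering n) P, ∀ a ∈ freeLabels j (fullOrdering n),
      (((g⁻¹ : GL (Fin 3) ℂ) : Matrix (Fin 3) (Fin 3) ℂ) *ᵥ
        puncture j (fullOrdering n) P x a) 2 ≠ 0)

end CEGM

end

namespace CEGM

/-! ### Brackets -/

/-! The proof combines gauge invariance with a separation of variables.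

Gauge invariance: a projective map `A` multiplies each bracket by `det A` and by one weight `μ a`
per label. By momentum conservation the weights cancel in the differential of the potential
(`potentialForm_comp_transport`), so solutions go to solutions. At a solution the Hessian is
congruent to its image via the Jacobian `D` (`det_hessian_transport`), so its determinant picks up
`(det D)^2`. Each free puncture contributes `det A * μ a ^ 3` to `det D`, and `V * PT` scales by
exactly this product, so each summand is invariant.

Separation: the two smaller label sets share only fixed punctures, and every nonzero invariant lies
in one of them. Each variable therefore sees only its own side: solutions form a product and the
Hessian is block diagonal. The cyclic brackets of the two parts multiply to those of the whole times
`V`, whence `V PT = (V PT_left) (V PT_right)`. The sum over pairs then factorizes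
(`Splits.integral_eq`).

The gauge change is made before splitting, since the parts need not conserve momentum at the four
fixed labels. -/

lemma bracket_smul_mulVec (A : Matrix (Fin 3) (Fin 3) ℂ) (a b c : ℂ) (u v w : Fin 3 → ℂ) :
    bracket (a • (A *ᵥ u)) (b • (A *ᵥ v)) (c • (A *ᵥ w)) =
      A.det * (a * b * c) * bracket u v w := by
  simp only [bracket, Matrix.det_fin_three, Matrix.of_apply, Matrix.cons_val', Matrix.cons_val_zero,
    Matrix.cons_val_one, Matrix.cons_val, Matrix.mulVec, dotProduct, Fin.sum_univ_three,
    Pi.smul_apply, smul_eq_mul]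
  ring

lemma exists_sort_eq {J : Finset ℕ} (hJ : J.card = 3) : ∃ a b c, J.sort = [a, b, c] := by
  have h : J.sort.length = 3 := by rw [Finset.length_sort, hJ]
  exact List.length_eq_three.1 h

lemma prod_eq_sort_map_prod (J : Finset ℕ) (f : ℕ → ℂ) : ∏ a ∈ J, f a = (J.sort.map f).prod := by
  conv_lhs => rw [← Finset.sort_toFinset J (· ≤ ·)]
  exact List.prod_toFinset f (Finset.sort_nodup J _)

lemma plucker_congr {J : Finset ℕ} (hJ : J.card = 3) {p q : ℕ → Fin 3 → ℂ}
    (h : ∀ a ∈ J, p a = q a) : plucker p J = plucker q J := by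
  obtain ⟨a, b, c, e⟩ := exists_sort_eq hJ
  have hm : ∀ x, x ∈ J ↔ x ∈ [a, b, c] := fun x => by rw [← e, Finset.mem_sort]
  simp only [plucker, e]
  simp [h a (by simp [hm]), h b (by simp [hm]), h c (by simp [hm])]

lemma plucker_smul_mulVec {J : Finset ℕ} (hJ : J.card = 3) (A : Matrix (Fin 3) (Fin 3) ℂ)
    {μ : ℕ → ℂ} {p q : ℕ → Fin 3 → ℂ} (h : ∀ a ∈ J, q a = μ a • (A *ᵥ p a)) :
    plucker q J = (A.det * ∏ a ∈ J, μ a) * plucker p J := by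
  rw [plucker_congr hJ h]
  obtain ⟨a, b, c, e⟩ := exists_sort_eq hJ
  rw [prod_eq_sort_map_prod]
  simp only [plucker, e]
  simp [bracket_smul_mulVec, mul_assoc]

/-! ### The potential as a logarithmic one-form -/

section potential

variable {j : ℕ} {α : List ℕ} {s : Finset ℕ → ℂ} {P : ℕ → Fin 3 → ℂ}

lemma contDiff_puncture (a : ℕ) (i : Fin 3) {m : WithTop ℕ∞} :
    ContDiff ℂ m fun x : Var j α → ℂ => puncture j α P x a i := by
  by_cases h : a ∈ freeLabels j α
  · simp only [puncture, h, dif_pos]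
    fin_cases i <;> simp <;> fun_prop
  · simp only [puncture, h, dif_neg, not_false_iff]
    fun_prop

lemma contDiff_plucker (J : Finset ℕ) {m : WithTop ℕ∞} :
    ContDiff ℂ m fun x : Var j α → ℂ => plucker (puncture j α P x) J := by
  have := fun a i => contDiff_puncture (j := j) (α := α) (P := P) (m := m) a i
  simp only [plucker, bracket, Matrix.det_fin_three, Matrix.of_apply, Matrix.cons_val',
    Matrix.cons_val_zero, Matrix.cons_val_one, Matrix.cons_val]
  fun_prop

/-- The differential `∑_J 𝔰_J d|J| / |J|` of the potential. -/
noncomputable def potentialForm (j : ℕ) (s : Finset ℕ → ℂ) (α : List ℕ) (P : ℕ → Fin 3 → ℂ)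
    (x : Var j α → ℂ) : (Var j α → ℂ) →L[ℂ] ℂ :=
  ∑ J ∈ α.toFinset.powersetCard 3, (s J * (plucker (puncture j α P x) J)⁻¹) •
    fderiv ℂ (fun y : Var j α → ℂ => plucker (puncture j α P y) J) x

lemma hasDerivAt_comp_update {ι F : Type*} [Fintype ι] [DecidableEq ι] [NormedAddCommGroup F]
    [NormedSpace ℂ F] {f : (ι → ℂ) → F} {x : ι → ℂ} (hf : DifferentiableAt ℂ f x) (k : ι) :
    HasDerivAt (fun z => f (Function.update x k z)) (fderiv ℂ f x (Pi.single k 1)) (x k) := by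
  have h1 := hasDerivAt_update x k (x k)
  have h2 : HasFDerivAt f (fderiv ℂ f x) (Function.update x k (x k)) := by
    rw [Function.update_eq_self]; exact hf.hasFDerivAt
  exact h2.comp_hasDerivAt _ h1

/-- A one-form obeys the chain rule under changes of coordinates. No nonvanishing is needed, because
`logDeriv` and the inverse use the same convention at a zero bracket. -/
lemma dPotential_eq (x : Var j α → ℂ) (k : Var j α) :
    dPotential j s α P x k = potentialForm j s α P x (Pi.single k 1) := by
  simp only [dPotential, potentialForm, _root_.sum_apply,
    _root_.smul_apply, smul_eq_mul]
  refine Finset.sum_congr rfl fun J _ => ?_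
  have h := hasDerivAt_comp_update
    ((contDiff_plucker (j := j) (α := α) (P := P) (m := 1) J).differentiable (by simp) x) k
  rw [logDeriv_apply, h.deriv, Function.update_eq_self]
  ring

lemma differentiableAt_potentialForm {x : Var j α → ℂ}
    (hx : ∀ J ∈ α.toFinset.powersetCard 3, s J ≠ 0 → plucker (puncture j α P x) J ≠ 0) :
    DifferentiableAt ℂ (potentialForm j s α P) x := by
  unfold potentialForm
  refine DifferentiableAt.fun_sum fun J hJ => ?_
  have hd : DifferentiableAt ℂ
      (fderiv ℂ (fun y : Var j α → ℂ => plucker (puncture j α P y) J)) x :=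
    ((contDiff_plucker (m := 2) J).fderiv_right (m := 1) (by norm_num)).differentiable
      (by simp) x
  -- With zero coefficient the bracket may vanish, and its inverse need not be differentiable; the
  -- term is then identically zero.
  by_cases hs : s J = 0
  · simp only [hs, zero_mul]
    exact hd.const_smul (0 : ℂ)
  · have hp := (contDiff_plucker (j := j) (α := α) (P := P) (m := 1) J).differentiable (by simp) x
    exact ((hp.inv (hx J hJ hs)).const_mul _).smul hd

lemma hessian_eq {x : Var j α → ℂ}
    (hx : ∀ J ∈ α.toFinset.powersetCard 3, s J ≠ 0 → plucker (puncture j α P x) J ≠ 0)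
    (k l : Var j α) :
    hessian j s α P x k l =
      fderiv ℂ (potentialForm j s α P) x (Pi.single l 1) (Pi.single k 1) := by
  have h := (hasDerivAt_comp_update (differentiableAt_potentialForm hx) l).clm_apply
    (hasDerivAt_const (x l) (Pi.single k (1 : ℂ)))
  simp only [hessian, Matrix.of_apply, dPotential_eq]
  rw [h.deriv]
  simp

lemma forall_dPotential_eq_zero_iff (x : Var j α → ℂ) :
    (∀ k, dPotential j s α P x k = 0) ↔ potentialForm j s α P x = 0 := by
  simp only [dPotential_eq]
  constructor
  · intro h
    ext v
    rw [← Finset.univ_sum_single v, map_sum]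
    refine Finset.sum_eq_zero fun k _ => ?_
    rw [← mul_one (v k), ← smul_eq_mul, Pi.single_smul, map_smul, h, smul_zero]
  · intro h k
    simp [h]

end potential

/-! ### Projective change of gauge -/

section gauge

variable {j : ℕ} {α : List ℕ} {s : Finset ℕ → ℂ} {P Q : ℕ → Fin 3 → ℂ}
  {A : Matrix (Fin 3) (Fin 3) ℂ} {c : ℕ → ℂ}

lemma puncture_of_mem {a : ℕ} (h : a ∈ freeLabels j α) (x : Var j α → ℂ) :
    puncture j α P x a = ![x (⟨a, h⟩, 0), x (⟨a, h⟩, 1), 1] := dif_pos h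

lemma puncture_of_notMem {a : ℕ} (h : a ∉ freeLabels j α) (x : Var j α → ℂ) :
    puncture j α P x a = P a := dif_neg h

lemma notMem_freeLabels_of_mem_fixedLabels {a : ℕ} (h : a ∈ fixedLabels j) :
    a ∉ freeLabels j α := fun h' => (Finset.mem_sdiff.1 h').2 h

lemma mem_fixedLabels_of_notMem_freeLabels {a : ℕ} (ha : a ∈ α.toFinset)
    (h : a ∉ freeLabels j α) : a ∈ fixedLabels j := by
  by_contra h'
  exact h (Finset.mem_sdiff.2 ⟨ha, h'⟩)

/-- The action on the free punctures, in inhomogeneous coordinates, of the projective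
transformation with matrix `A`. -/
noncomputable def transport (A : Matrix (Fin 3) (Fin 3) ℂ) (j : ℕ) (α : List ℕ)
    (P : ℕ → Fin 3 → ℂ) (x : Var j α → ℂ) : Var j α → ℂ := fun k =>
  (A *ᵥ puncture j α P x k.1) k.2.castSucc / (A *ᵥ puncture j α P x k.1) 2

/-- The factor by which the homogeneous coordinates of a puncture are rescaled. -/
noncomputable def scaleFactor (A : Matrix (Fin 3) (Fin 3) ℂ) (c : ℕ → ℂ) (j : ℕ) (α : List ℕ)
    (P : ℕ → Fin 3 → ℂ) (x : Var j α → ℂ) (a : ℕ) : ℂ :=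
  if a ∈ freeLabels j α then ((A *ᵥ puncture j α P x a) 2)⁻¹ else c a

/-- No free puncture is moved to the line at infinity by `A`. -/
def AvoidsInfinity (A : Matrix (Fin 3) (Fin 3) ℂ) (j : ℕ) (α : List ℕ) (P : ℕ → Fin 3 → ℂ)
    (x : Var j α → ℂ) : Prop :=
  ∀ a ∈ freeLabels j α, (A *ᵥ puncture j α P x a) 2 ≠ 0

lemma puncture_transport (hQ : ∀ a ∈ fixedLabels j, Q a = c a • (A *ᵥ P a)) {x : Var j α → ℂ}
    (hx : AvoidsInfinity A j α P x) {a : ℕ} (ha : a ∈ α.toFinset) :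
    puncture j α Q (transport A j α P x) a =
      scaleFactor A c j α P x a • (A *ᵥ puncture j α P x a) := by
  by_cases h : a ∈ freeLabels j α
  · have := hx a h
    rw [puncture_of_mem h, scaleFactor, if_pos h]
    ext i
    fin_cases i
    · simp [transport, div_eq_inv_mul]
    · simp [transport, div_eq_inv_mul]
    · simp [this]
  · rw [puncture_of_notMem h, puncture_of_notMem h, scaleFactor, if_neg h,
      hQ a (mem_fixedLabels_of_notMem_freeLabels ha h)]

lemma scaleFactor_ne_zero (hc : ∀ a ∈ fixedLabels j, c a ≠ 0) {x : Var j α → ℂ}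
    (hx : AvoidsInfinity A j α P x) {a : ℕ} (ha : a ∈ α.toFinset) :
    scaleFactor A c j α P x a ≠ 0 := by
  by_cases h : a ∈ freeLabels j α
  · rw [scaleFactor, if_pos h]; exact inv_ne_zero (hx a h)
  · rw [scaleFactor, if_neg h]; exact hc a (mem_fixedLabels_of_notMem_freeLabels ha h)

lemma contDiff_mulVec_puncture (a : ℕ) (i : Fin 3) {m : WithTop ℕ∞} :
    ContDiff ℂ m fun x : Var j α → ℂ => (A *ᵥ puncture j α P x a) i := by
  have := fun i => contDiff_puncture (j := j) (α := α) (P := P) (m := m) a i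
  simp only [Matrix.mulVec, dotProduct]
  fun_prop

/-- Openness of the condition lets the transformation laws, valid only where it holds, be
differentiated at `x`. -/
lemma eventually_avoidsInfinity {x : Var j α → ℂ} (hx : AvoidsInfinity A j α P x) :
    ∀ᶠ y in nhds x, AvoidsInfinity A j α P y := by
  simp only [AvoidsInfinity]
  rw [Filter.eventually_all_finset]
  intro a ha
  exact (contDiff_mulVec_puncture (m := 0) a 2).continuous.continuousAt.eventually_ne (hx a ha)

lemma contDiffAt_transport {x : Var j α → ℂ} (hx : AvoidsInfinity A j α P x) {m : WithTop ℕ∞} :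
    ContDiffAt ℂ m (transport A j α P) x := by
  rw [contDiffAt_pi]
  exact fun k => (contDiff_mulVec_puncture _ _).contDiffAt.div
    (contDiff_mulVec_puncture _ _).contDiffAt (hx _ k.1.2)

lemma differentiableAt_scaleFactor {x : Var j α → ℂ} (hx : AvoidsInfinity A j α P x) (a : ℕ) :
    DifferentiableAt ℂ (fun y => scaleFactor A c j α P y a) x := by
  by_cases h : a ∈ freeLabels j α
  · simp only [scaleFactor, if_pos h]
    exact ((contDiff_mulVec_puncture (m := 1) a 2).differentiable (by simp) x).inv (hx a h)
  · simp only [scaleFactor, if_neg h]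
    exact differentiableAt_const _

lemma plucker_transport (hQ : ∀ a ∈ fixedLabels j, Q a = c a • (A *ᵥ P a)) {x : Var j α → ℂ}
    (hx : AvoidsInfinity A j α P x) {J : Finset ℕ} (hJ : J ∈ α.toFinset.powersetCard 3) :
    plucker (puncture j α Q (transport A j α P x)) J =
      (A.det * ∏ a ∈ J, scaleFactor A c j α P x a) * plucker (puncture j α P x) J := by
  obtain ⟨h1, h2⟩ := Finset.mem_powersetCard.1 hJ
  exact plucker_smul_mulVec h2 A fun a ha => puncture_transport hQ hx (h1 ha)

lemma hasFDerivAt_finset_prod_inv {ι E : Type*} [DecidableEq ι] [NormedAddCommGroup E]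
    [NormedSpace ℂ E] {J : Finset ι} {f : ι → E → ℂ} {x : E}
    (hf : ∀ i ∈ J, DifferentiableAt ℂ (f i) x) (h0 : ∀ i ∈ J, f i x ≠ 0) :
    HasFDerivAt (fun y => ∏ i ∈ J, f i y)
      ((∏ i ∈ J, f i x) • ∑ i ∈ J, (f i x)⁻¹ • fderiv ℂ (f i) x) x := by
  refine (HasFDerivAt.finsetProd (u := J) fun i hi => (hf i hi).hasFDerivAt).congr_fderiv ?_
  rw [Finset.smul_sum]
  refine Finset.sum_congr rfl fun i hi => ?_
  rw [smul_smul, ← Finset.mul_prod_erase _ _ hi]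
  congr 1
  field_simp [h0 i hi]

/-- Exchanging the sums, the coefficient of `d a` is the momentum conservation sum at `a`. -/
lemma sum_smul_sum_eq_zero {M : Type*} [AddCommGroup M] [Module ℂ M] {S : Finset ℕ}
    (hcons : ∀ a ∈ S, ∑ J ∈ (S.powersetCard 3).filter (fun J => a ∈ J), s J = 0) (d : ℕ → M) :
    ∑ J ∈ S.powersetCard 3, s J • ∑ a ∈ J, d a = 0 := by
  simp only [Finset.smul_sum]
  rw [Finset.sum_comm' (t' := S) (s' := fun a => (S.powersetCard 3).filter (fun J => a ∈ J))]
  · refine Finset.sum_eq_zero fun a ha => ?_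
    rw [← Finset.sum_smul, hcons a ha, zero_smul]
  · intro J a
    simp only [Finset.mem_filter, Finset.mem_powersetCard]
    exact ⟨fun h => ⟨h, h.1.1 h.2⟩, fun h => h.1⟩

/-- By momentum conservation, the differential of the potential is projectively covariant. -/
lemma potentialForm_comp_transport
    (hcons : ∀ a ∈ α.toFinset,
      ∑ J ∈ (α.toFinset.powersetCard 3).filter (fun J => a ∈ J), s J = 0)
    (hA : A.det ≠ 0) (hc : ∀ a ∈ fixedLabels j, c a ≠ 0)
    (hQ : ∀ a ∈ fixedLabels j, Q a = c a • (A *ᵥ P a)) {x : Var j α → ℂ}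
    (hx : AvoidsInfinity A j α P x)
    (hp : ∀ J ∈ α.toFinset.powersetCard 3, s J ≠ 0 → plucker (puncture j α P x) J ≠ 0) :
    (potentialForm j s α Q (transport A j α P x)) ∘L fderiv ℂ (transport A j α P) x =
      potentialForm j s α P x := by
  -- The logarithmic differential of the weight of `a`.
  set d : ℕ → ((Var j α → ℂ) →L[ℂ] ℂ) := fun a =>
    (scaleFactor A c j α P x a)⁻¹ • fderiv ℂ (fun y => scaleFactor A c j α P y a) x
  have key : (potentialForm j s α Q (transport A j α P x)) ∘L fderiv ℂ (transport A j α P) x =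
      potentialForm j s α P x + ∑ J ∈ α.toFinset.powersetCard 3, s J • ∑ a ∈ J, d a := by
    rw [potentialForm, potentialForm, ← Finset.sum_add_distrib, ContinuousLinearMap.finsetSum_comp]
    refine Finset.sum_congr rfl fun J hJ => ?_
    by_cases hs : s J = 0
    · ext v
      simp [hs]
    have hp0 := hp J hJ hs
    have hJs : ∀ a ∈ J, scaleFactor A c j α P x a ≠ 0 := fun a ha =>
      scaleFactor_ne_zero hc hx ((Finset.mem_powersetCard.1 hJ).1 ha)
    have hd1 := (((contDiff_plucker (j := j) (α := α) (P := Q) (m := 1) J).differentiable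
      (by simp) (transport A j α P x)).hasFDerivAt).comp x
      (((contDiffAt_transport (m := 1) hx).differentiableAt (by simp)).hasFDerivAt)
    have hd2 := ((hasFDerivAt_finset_prod_inv
      (fun a (_ : a ∈ J) => differentiableAt_scaleFactor (c := c) hx a) hJs).const_mul A.det).mul
      (((contDiff_plucker (j := j) (α := α) (P := P) (m := 1) J).differentiable
        (by simp) x).hasFDerivAt)
    -- Two derivatives of one function, the transported bracket: by the chain rule, and by the
    -- product rule on its scaling law.
    have he := hd1.unique (hd2.congr_of_eventuallyEq
      ((eventually_avoidsInfinity hx).mono fun y hy => plucker_transport hQ hy hJ))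
    rw [ContinuousLinearMap.smul_comp, he, plucker_transport hQ hx hJ]
    have hpr : ∏ a ∈ J, scaleFactor A c j α P x a ≠ 0 := Finset.prod_ne_zero_iff.2 hJs
    simp only [smul_add, smul_smul, d]
    congr 2
    · field_simp
    · field_simp
  rw [key, sum_smul_sum_eq_zero hcons, add_zero]

/-! ### Jacobian of a projective transformation -/

lemma mulVec_puncture {a : ℕ} (h : a ∈ freeLabels j α) (x : Var j α → ℂ) (i : Fin 3) :
    (A *ᵥ puncture j α P x a) i = A i 0 * x (⟨a, h⟩, 0) + A i 1 * x (⟨a, h⟩, 1) + A i 2 := by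
  rw [puncture_of_mem h]
  simp [Matrix.mulVec, dotProduct, Fin.sum_univ_three]

lemma hasDerivAt_mulVec_puncture_update (x : Var j α → ℂ) (a : freeLabels j α) (l : Var j α)
    (i : Fin 3) :
    HasDerivAt (fun z => (A *ᵥ puncture j α P (Function.update x l z) a) i)
      (if a = l.1 then A i l.2.castSucc else 0) (x l) := by
  obtain ⟨b, u⟩ := l
  simp only [mulVec_puncture a.2]
  have hu : ∀ k : Var j α, HasDerivAt (fun z => Function.update x (b, u) z k)
      ((Pi.single (b, u) 1 : Var j α → ℂ) k) (x (b, u)) := fun k =>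
    hasDerivAt_pi.1 (hasDerivAt_update x (b, u) (x (b, u))) k
  refine ((((hu (a, 0)).const_mul (A i 0)).add ((hu (a, 1)).const_mul (A i 1))).add_const
    (A i 2)).congr_deriv ?_
  by_cases hab : a = b
  · subst hab
    fin_cases u <;> simp
  · simp [hab]

/-- The Jacobian of a projective transformation at one puncture. -/
noncomputable def localJacobian (A : Matrix (Fin 3) (Fin 3) ℂ) (p : Fin 3 → ℂ) :
    Matrix (Fin 2) (Fin 2) ℂ :=
  Matrix.of fun t u => (A t.castSucc u.castSucc * (A *ᵥ p) 2 - (A *ᵥ p) t.castSucc *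
    A 2 u.castSucc) / (A *ᵥ p) 2 ^ 2

lemma det_localJacobian {p : Fin 3 → ℂ} (hp : p 2 = 1) (h : (A *ᵥ p) 2 ≠ 0) :
    (localJacobian A p).det = A.det * ((A *ᵥ p) 2)⁻¹ ^ 3 := by
  have h' : ∀ i, (A *ᵥ p) i = A i 0 * p 0 + A i 1 * p 1 + A i 2 := fun i => by
    simp [Matrix.mulVec, dotProduct, Fin.sum_univ_three, hp]
  -- Eliminating `A 2 2` keeps the denominator atomic, so clearing it leaves a polynomial identity.
  have h2 : A 2 2 = (A *ᵥ p) 2 - A 2 0 * p 0 - A 2 1 * p 1 := by rw [h']; ring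
  rw [Matrix.det_fin_two, Matrix.det_fin_three]
  simp only [localJacobian, Matrix.of_apply, Fin.castSucc_zero, Fin.castSucc_one]
  rw [h' 0, h' 1, h2]
  field_simp
  ring

lemma toMatrix_fderiv_transport {x : Var j α → ℂ} (hx : AvoidsInfinity A j α P x)
    (k l : Var j α) :
    LinearMap.toMatrix' (fderiv ℂ (transport A j α P) x : (Var j α → ℂ) →ₗ[ℂ] (Var j α → ℂ)) k l =
      if k.1 = l.1 then localJacobian A (puncture j α P x k.1) k.2 l.2 else 0 := by
  have h1 := hasDerivAt_pi.1 (hasDerivAt_comp_update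
    ((contDiffAt_transport (m := 1) hx).differentiableAt (by simp)) l) k
  have hne : (A *ᵥ puncture j α P (Function.update x l (x l)) k.1) 2 ≠ 0 := by
    rw [Function.update_eq_self]; exact hx _ k.1.2
  have h2 := (hasDerivAt_mulVec_puncture_update (P := P) (A := A) x k.1 l k.2.castSucc).div
    (hasDerivAt_mulVec_puncture_update x k.1 l 2) hne
  rw [LinearMap.toMatrix'_apply]
  have h3 := h1.unique h2
  rw [Function.update_eq_self] at h3
  refine h3.trans ?_
  by_cases hkl : k.1 = l.1
  · simp [hkl, localJacobian]
  · simp [hkl]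

/-- The image of a puncture depends on that puncture alone, so the Jacobian has one `2 × 2` block
per free label. -/
lemma det_toMatrix_fderiv_transport {x : Var j α → ℂ} (hx : AvoidsInfinity A j α P x) :
    (LinearMap.toMatrix' (fderiv ℂ (transport A j α P) x :
      (Var j α → ℂ) →ₗ[ℂ] (Var j α → ℂ))).det =
      ∏ a ∈ freeLabels j α, (A.det * scaleFactor A c j α P x a ^ 3) := by
  have h : LinearMap.toMatrix' (fderiv ℂ (transport A j α P) x :
      (Var j α → ℂ) →ₗ[ℂ] (Var j α → ℂ)) =
      Matrix.reindex (Equiv.prodComm _ _) (Equiv.prodComm _ _)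
        (Matrix.blockDiagonal fun a : freeLabels j α =>
          localJacobian A (puncture j α P x a)) := by
    ext k l
    rw [toMatrix_fderiv_transport hx]
    simp [Matrix.blockDiagonal_apply]
  rw [h, Matrix.det_reindex_self, Matrix.det_blockDiagonal,
    ← Finset.prod_coe_sort (freeLabels j α)]
  refine Finset.prod_congr rfl fun a _ => ?_
  rw [scaleFactor, if_pos a.2]
  exact det_localJacobian (by rw [puncture_of_mem a.2]; simp) (hx a a.2)

/-! ### Scattering equations and Hessian under a change of gauge -/

lemma mem_solutions_iff {x : Var j α → ℂ} : x ∈ solutions j s α P ↔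
    (∀ J ∈ α.toFinset.powersetCard 3, s J ≠ 0 → plucker (puncture j α P x) J ≠ 0) ∧
    (∏ i ∈ Finset.range α.length, consecutive α (puncture j α P x) i ≠ 0) ∧
    potentialForm j s α P x = 0 := by
  rw [← forall_dPotential_eq_zero_iff, Finset.prod_ne_zero_iff]
  rfl

lemma plucker_transport_ne_zero (hA : A.det ≠ 0) (hc : ∀ a ∈ fixedLabels j, c a ≠ 0)
    (hQ : ∀ a ∈ fixedLabels j, Q a = c a • (A *ᵥ P a)) {x : Var j α → ℂ}
    (hx : AvoidsInfinity A j α P x) {J : Finset ℕ} (hJ : J ∈ α.toFinset.powersetCard 3)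
    (h : plucker (puncture j α P x) J ≠ 0) :
    plucker (puncture j α Q (transport A j α P x)) J ≠ 0 := by
  rw [plucker_transport hQ hx hJ]
  exact mul_ne_zero (mul_ne_zero hA (Finset.prod_ne_zero_iff.2 fun a ha =>
    scaleFactor_ne_zero hc hx ((Finset.mem_powersetCard.1 hJ).1 ha))) h

lemma det_toMatrix_fderiv_transport_ne_zero (hA : A.det ≠ 0) {x : Var j α → ℂ}
    (hx : AvoidsInfinity A j α P x) :
    (LinearMap.toMatrix' (fderiv ℂ (transport A j α P) x :
      (Var j α → ℂ) →ₗ[ℂ] (Var j α → ℂ))).det ≠ 0 := by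
  -- Only weights of free labels occur, and these do not involve `c`.
  rw [det_toMatrix_fderiv_transport (c := 0) hx]
  refine Finset.prod_ne_zero_iff.2 fun a ha => mul_ne_zero hA (pow_ne_zero _ ?_)
  rw [scaleFactor, if_pos ha]
  exact inv_ne_zero (hx a ha)

/-- Covariance kills the form on the image of the Jacobian, which is everything since the Jacobian
is invertible. -/
lemma potentialForm_transport_eq_zero
    (hcons : ∀ a ∈ α.toFinset,
      ∑ J ∈ (α.toFinset.powersetCard 3).filter (fun J => a ∈ J), s J = 0)
    (hA : A.det ≠ 0) (hc : ∀ a ∈ fixedLabels j, c a ≠ 0)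
    (hQ : ∀ a ∈ fixedLabels j, Q a = c a • (A *ᵥ P a)) {x : Var j α → ℂ}
    (hx : AvoidsInfinity A j α P x) (hsol : x ∈ solutions j s α P) :
    potentialForm j s α Q (transport A j α P x) = 0 := by
  obtain ⟨hp, -, h0⟩ := mem_solutions_iff.1 hsol
  have h := potentialForm_comp_transport hcons hA hc hQ hx hp
  rw [h0] at h
  set D := (fderiv ℂ (transport A j α P) x : (Var j α → ℂ) →ₗ[ℂ] (Var j α → ℂ)) with hD
  have hdet : IsUnit (LinearMap.det D) := by
    rw [← LinearMap.det_toMatrix']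
    exact (det_toMatrix_fderiv_transport_ne_zero hA hx).isUnit
  have hsurj : Function.Surjective D := 
    ((Module.End.isUnit_iff D).1 ((LinearMap.isUnit_iff_isUnit_det D).2 hdet)).2
  ext v
  obtain ⟨w, rfl⟩ := hsurj v
  exact DFunLike.congr_fun h w

/-- Differentiating the covariance law gives a congruence plus a term pairing the form with the
second derivative of `transport`; at a solution the form, hence this term, vanishes. -/
lemma det_hessian_transport
    (hcons : ∀ a ∈ α.toFinset,
      ∑ J ∈ (α.toFinset.powersetCard 3).filter (fun J => a ∈ J), s J = 0)
    (hA : A.det ≠ 0) (hc : ∀ a ∈ fixedLabels j, c a ≠ 0)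
    (hQ : ∀ a ∈ fixedLabels j, Q a = c a • (A *ᵥ P a)) {x : Var j α → ℂ}
    (hx : AvoidsInfinity A j α P x) (hsol : x ∈ solutions j s α P) :
    (hessian j s α P x).det =
      (∏ a ∈ freeLabels j α, (A.det * scaleFactor A c j α P x a ^ 3)) ^ 2 *
        (hessian j s α Q (transport A j α P x)).det := by
  obtain ⟨hp, -, -⟩ := mem_solutions_iff.1 hsol
  have hp' : ∀ J ∈ α.toFinset.powersetCard 3, s J ≠ 0 →
      plucker (puncture j α Q (transport A j α P x)) J ≠ 0 := fun J hJ hs =>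
    plucker_transport_ne_zero hA hc hQ hx hJ (hp J hJ hs)
  have h0 := potentialForm_transport_eq_zero hcons hA hc hQ hx hsol
  have hp_ev : ∀ᶠ y in nhds x, ∀ J ∈ α.toFinset.powersetCard 3, s J ≠ 0 →
      plucker (puncture j α P y) J ≠ 0 := by
    rw [Filter.eventually_all_finset]
    intro J hJ
    by_cases hs : s J = 0
    · simp [hs]
    · filter_upwards [(contDiff_plucker (P := P) (m := 0) J).continuous.continuousAt.eventually_ne
        (hp J hJ hs)] with y hy _ using hy
  have hev : ∀ᶠ y in nhds x, potentialForm j s α P y =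
      (potentialForm j s α Q (transport A j α P y)) ∘L fderiv ℂ (transport A j α P) y := by
    filter_upwards [hp_ev, eventually_avoidsInfinity hx] with y h1 h2
    exact (potentialForm_comp_transport hcons hA hc hQ h2 h1).symm
  have hT := ((contDiffAt_transport (m := 1) hx).differentiableAt (by simp)).hasFDerivAt
  have hT2 := (((contDiffAt_transport (m := 2) hx).fderiv_right (m := 1)
    (by norm_num)).differentiableAt (by simp)).hasFDerivAt
  have hω := (differentiableAt_potentialForm hp').hasFDerivAt.comp x hT
  have hfd := ((hω.clm_comp hT2).congr_of_eventuallyEq hev).fderiv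
  set D := fderiv ℂ (transport A j α P) x with hD
  set M := LinearMap.toMatrix' (D : (Var j α → ℂ) →ₗ[ℂ] (Var j α → ℂ)) with hM
  have hmat : (hessian j s α P x)ᵀ =
      Mᵀ * (hessian j s α Q (transport A j α P x))ᵀ * M := by
    set B := (fderiv ℂ (potentialForm j s α Q) (transport A j α P x)).toLinearMap₁₂ with hB
    have hQH : (hessian j s α Q (transport A j α P x))ᵀ = LinearMap.toMatrix₂' ℂ B := by
      ext k l
      rw [LinearMap.toMatrix₂'_apply, Matrix.transpose_apply, hessian_eq hp']
      rfl
    rw [hQH, hM, ← LinearMap.toMatrix₂'_compl₁₂]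
    ext k l
    rw [LinearMap.toMatrix₂'_apply, Matrix.transpose_apply, hessian_eq hp, hfd]
    simp [h0, hB]
  rw [← Matrix.det_transpose, hmat, Matrix.det_mul, Matrix.det_mul, Matrix.det_transpose,
    Matrix.det_transpose, det_toMatrix_fderiv_transport (c := c) hx]
  ring

/-! ### Scaling weights of the Parke–Taylor and Faddeev–Popov factors -/

lemma prod_range_succ_mod {M : Type*} [CommMonoid M] (f : ℕ → M) (m : ℕ) :
    ∏ i ∈ Finset.range m, f ((i + 1) % m) = ∏ i ∈ Finset.range m, f i := by
  obtain _ | m := m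
  · simp
  · rw [Finset.prod_range_succ, Finset.prod_range_succ' f, Nat.mod_self]
    congr 1
    refine Finset.prod_congr rfl fun i hi => ?_
    rw [Nat.mod_eq_of_lt (by simpa using hi)]

lemma prod_range_getD {M : Type*} [CommMonoid M] (hα : α.Nodup) (f : ℕ → M) :
    ∏ i ∈ Finset.range α.length, f (α.getD i 0) = ∏ a ∈ α.toFinset, f a := by
  rw [List.prod_toFinset f hα, ← Fin.prod_univ_eq_prod_range (fun i => f (α.getD i 0)),
    ← List.prod_ofFn]
  congr 1
  refine List.ext_getElem (by simp) fun i h1 h2 => ?_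
  simp

/-- Around the cycle each label occupies each of the three bracket slots once, hence the cube. -/
lemma prod_consecutive_smul_mulVec (hα : α.Nodup) {μ : ℕ → ℂ} {p q : ℕ → Fin 3 → ℂ}
    (h : ∀ a ∈ α.toFinset, q a = μ a • (A *ᵥ p a)) :
    ∏ i ∈ Finset.range α.length, consecutive α q i =
      A.det ^ α.length * (∏ a ∈ α.toFinset, μ a) ^ 3 *
        ∏ i ∈ Finset.range α.length, consecutive α p i := by
  have hm : ∀ i < α.length, α.getD i 0 ∈ α.toFinset := fun i hi => by
    rw [List.getD_eq_getElem _ _ hi]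
    exact List.mem_toFinset.2 (List.getElem_mem hi)
  have h1 : ∀ i ∈ Finset.range α.length, consecutive α q i =
      A.det * (μ (α.getD (i % α.length) 0) * μ (α.getD ((i + 1) % α.length) 0) *
        μ (α.getD ((i + 2) % α.length) 0)) * consecutive α p i := fun i hi => by
    have h0 : 0 < α.length := (Nat.zero_le i).trans_lt (Finset.mem_range.1 hi)
    have := fun k => hm (k % α.length) (Nat.mod_lt _ h0)
    rw [consecutive, h _ (this i), h _ (this (i + 1)), h _ (this (i + 2)), bracket_smul_mulVec]
    rfl
  rw [Finset.prod_congr rfl h1]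
  simp only [Finset.prod_mul_distrib, Finset.prod_const, Finset.card_range]
  have e0 : ∏ i ∈ Finset.range α.length, μ (α.getD (i % α.length) 0) = ∏ a ∈ α.toFinset, μ a := by
    rw [← prod_range_getD hα]
    refine Finset.prod_congr rfl fun i hi => ?_
    rw [Nat.mod_eq_of_lt (Finset.mem_range.1 hi)]
  have e1 : ∏ i ∈ Finset.range α.length, μ (α.getD ((i + 1) % α.length) 0) =
      ∏ a ∈ α.toFinset, μ a := by
    rw [prod_range_succ_mod fun i => μ (α.getD i 0), prod_range_getD hα]
  have e2 : ∏ i ∈ Finset.range α.length, μ (α.getD ((i + 2) % α.length) 0) =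
      ∏ a ∈ α.toFinset, μ a := by
    rw [← e1, ← prod_range_succ_mod fun i => μ (α.getD ((i + 1) % α.length) 0)]
    simp
  rw [e0, e1, e2]
  ring

lemma prod_fixedLabels (hj : 3 ≤ j) (f : ℕ → ℂ) :
    ∏ a ∈ fixedLabels j, f a = f 1 * f 2 * f j * f (j + 1) := by
  rw [fixedLabels, Finset.prod_insert, Finset.prod_insert, Finset.prod_insert,
    Finset.prod_singleton]
  · ring
  all_goals simp; try omega

lemma faddeevPopov_smul_mulVec (hj : 3 ≤ j) {μ : ℕ → ℂ} {p q : ℕ → Fin 3 → ℂ}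
    (h : ∀ a ∈ fixedLabels j, q a = μ a • (A *ᵥ p a)) :
    faddeevPopov j q = A.det ^ 4 * (∏ a ∈ fixedLabels j, μ a) ^ 3 * faddeevPopov j p := by
  rw [faddeevPopov, h 1 (by simp [fixedLabels]), h 2 (by simp [fixedLabels]),
    h j (by simp [fixedLabels]), h (j + 1) (by simp [fixedLabels]), prod_fixedLabels hj]
  simp only [bracket_smul_mulVec]
  rw [faddeevPopov]
  ring

lemma card_fixedLabels (hj : 3 ≤ j) : (fixedLabels j).card = 4 := by
  rw [fixedLabels, Finset.card_insert_of_notMem, Finset.card_insert_of_notMem,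
    Finset.card_insert_of_notMem, Finset.card_singleton]
  all_goals simp; try omega

/-- The Faddeev–Popov and Parke–Taylor factors transform with the inverse Jacobian. -/
lemma faddeevPopov_mul_parkeTaylor_transport (hj : 3 ≤ j) (hα : α.Nodup)
    (hfix : fixedLabels j ⊆ α.toFinset) (hA : A.det ≠ 0) (hc : ∀ a ∈ fixedLabels j, c a ≠ 0)
    (hQ : ∀ a ∈ fixedLabels j, Q a = c a • (A *ᵥ P a)) {x : Var j α → ℂ}
    (hx : AvoidsInfinity A j α P x) :
    faddeevPopov j (puncture j α P x) * parkeTaylor α (puncture j α P x) =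
      (∏ a ∈ freeLabels j α, (A.det * scaleFactor A c j α P x a ^ 3)) *
        (faddeevPopov j (puncture j α Q (transport A j α P x)) *
          parkeTaylor α (puncture j α Q (transport A j α P x))) := by
  have hq : ∀ a ∈ α.toFinset, puncture j α Q (transport A j α P x) a =
      scaleFactor A c j α P x a • (A *ᵥ puncture j α P x a) := fun a ha =>
    puncture_transport hQ hx ha
  rw [parkeTaylor, parkeTaylor, prod_consecutive_smul_mulVec hα hq,
    faddeevPopov_smul_mulVec hj fun a ha => hq a (hfix ha)]
  have hne : ∀ a ∈ α.toFinset, scaleFactor A c j α P x a ≠ 0 := fun a ha =>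
    scaleFactor_ne_zero hc hx ha
  -- The four brackets of `V` absorb the excess of cyclic brackets over free labels, leaving one
  -- `det A` per free label.
  have hlen : α.length = (freeLabels j α).card + 4 := by
    rw [freeLabels, Finset.card_sdiff_of_subset hfix, card_fixedLabels hj,
      List.toFinset_card_of_nodup hα]
    have := Finset.card_le_card hfix
    rw [card_fixedLabels hj, List.toFinset_card_of_nodup hα] at this
    omega
  have hsplit : ∏ a ∈ α.toFinset, scaleFactor A c j α P x a =
      (∏ a ∈ freeLabels j α, scaleFactor A c j α P x a) *
        ∏ a ∈ fixedLabels j, scaleFactor A c j α P x a :=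
    (Finset.prod_sdiff hfix).symm
  have h1 : ∏ a ∈ freeLabels j α, scaleFactor A c j α P x a ≠ 0 :=
    Finset.prod_ne_zero_iff.2 fun a ha => hne a (Finset.mem_sdiff.1 ha).1
  have h2 : ∏ a ∈ fixedLabels j, scaleFactor A c j α P x a ≠ 0 :=
    Finset.prod_ne_zero_iff.2 fun a ha => hne a (hfix ha)
  rw [Finset.prod_mul_distrib, Finset.prod_const, Finset.prod_pow, hsplit,
    show A.det ^ α.length = A.det ^ (freeLabels j α).card * A.det ^ 4 by rw [hlen, pow_add]]
  generalize ∏ i ∈ Finset.range α.length, consecutive α (puncture j α P x) i = C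
  -- If a consecutive bracket vanishes, both sides are zero by the convention `1 / 0 = 0`.
  by_cases hC : C = 0
  · simp [hC]
  · field_simp

/-! ### Bijection between solutions in two gauges -/

lemma transport_mem_solutions (hα : α.Nodup)
    (hcons : ∀ a ∈ α.toFinset,
      ∑ J ∈ (α.toFinset.powersetCard 3).filter (fun J => a ∈ J), s J = 0)
    (hA : A.det ≠ 0) (hc : ∀ a ∈ fixedLabels j, c a ≠ 0)
    (hQ : ∀ a ∈ fixedLabels j, Q a = c a • (A *ᵥ P a)) {x : Var j α → ℂ}
    (hx : AvoidsInfinity A j α P x) (hsol : x ∈ solutions j s α P) :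
    transport A j α P x ∈ solutions j s α Q := by
  obtain ⟨hp, hC, -⟩ := mem_solutions_iff.1 hsol
  refine mem_solutions_iff.2 ⟨fun J hJ hs =>
    plucker_transport_ne_zero hA hc hQ hx hJ (hp J hJ hs), ?_,
    potentialForm_transport_eq_zero hcons hA hc hQ hx hsol⟩
  rw [prod_consecutive_smul_mulVec hα fun a ha => puncture_transport (c := c) hQ hx ha]
  exact mul_ne_zero (mul_ne_zero (pow_ne_zero _ hA) (pow_ne_zero _
    (Finset.prod_ne_zero_iff.2 fun a ha => scaleFactor_ne_zero hc hx ha))) hC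

lemma transport_transport {B : Matrix (Fin 3) (Fin 3) ℂ} (hBA : B * A = 1)
    (hQ : ∀ a ∈ fixedLabels j, Q a = c a • (A *ᵥ P a)) {x : Var j α → ℂ}
    (hx : AvoidsInfinity A j α P x) :
    transport B j α Q (transport A j α P x) = x := by
  funext k
  obtain ⟨⟨a, ha⟩, t⟩ := k
  have hne := hx a ha
  have h := puncture_transport hQ hx (Finset.mem_sdiff.1 ha).1
  rw [scaleFactor, if_pos ha] at h
  rw [transport, h, Matrix.mulVec_smul, Matrix.mulVec_mulVec, hBA, Matrix.one_mulVec]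
  have h2 : puncture j α P x a 2 = 1 := by rw [puncture_of_mem ha]; simp
  have h3 : puncture j α P x a t.castSucc = x (⟨a, ha⟩, t) := by
    rw [puncture_of_mem ha]; fin_cases t <;> simp
  simp only [Pi.smul_apply, smul_eq_mul, h2, h3]
  field_simp

/-- The integral and its regularity do not depend on the gauge. -/
theorem integral_eq_and_isRegular_iff_of_gauge (hj : 3 ≤ j) (hα : α.Nodup)
    (hfix : fixedLabels j ⊆ α.toFinset)
    (hcons : ∀ a ∈ α.toFinset,
      ∑ J ∈ (α.toFinset.powersetCard 3).filter (fun J => a ∈ J), s J = 0)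
    {B : Matrix (Fin 3) (Fin 3) ℂ} (hBA : B * A = 1) (hc : ∀ a ∈ fixedLabels j, c a ≠ 0)
    (hQ : ∀ a ∈ fixedLabels j, Q a = c a • (A *ᵥ P a))
    (hP : ∀ x ∈ solutions j s α P, AvoidsInfinity A j α P x)
    (hQ' : ∀ x ∈ solutions j s α Q, AvoidsInfinity B j α Q x) :
    integral j s α Q = integral j s α P ∧ (IsRegular j s α Q ↔ IsRegular j s α P) ∧
      ((solutions j s α Q).Nonempty ↔ (solutions j s α P).Nonempty) := by
  have hAB : A * B = 1 := mul_eq_one_comm.1 hBA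
  have hdet : B.det * A.det = 1 := by rw [← Matrix.det_mul, hBA, Matrix.det_one]
  have hA : A.det ≠ 0 := right_ne_zero_of_mul_eq_one hdet
  have hB : B.det ≠ 0 := left_ne_zero_of_mul_eq_one hdet
  have hc' : ∀ a ∈ fixedLabels j, (c a)⁻¹ ≠ 0 := fun a ha => inv_ne_zero (hc a ha)
  have hQP : ∀ a ∈ fixedLabels j, P a = (c a)⁻¹ • (B *ᵥ Q a) := fun a ha => by
    rw [hQ a ha, Matrix.mulVec_smul, Matrix.mulVec_mulVec, hBA, Matrix.one_mulVec, smul_smul,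
      inv_mul_cancel₀ (hc a ha), one_smul]
  -- Genericity is needed in both directions, so that each transport is defined on the other gauge's
  -- solutions.
  have hbij : Set.BijOn (transport A j α P) (solutions j s α P) (solutions j s α Q) :=
    Set.InvOn.bijOn (f' := transport B j α Q)
      ⟨fun x hx => transport_transport hBA hQ (hP x hx),
        fun x hx => transport_transport hAB hQP (hQ' x hx)⟩
      (fun x hx => transport_mem_solutions hα hcons hA hc hQ (hP x hx) hx)
      (fun x hx => transport_mem_solutions hα hcons hB hc' hQP (hQ' x hx) hx)
  have hJ : ∀ x ∈ solutions j s α P,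
      ∏ a ∈ freeLabels j α, (A.det * scaleFactor A c j α P x a ^ 3) ≠ 0 := fun x hx =>
    Finset.prod_ne_zero_iff.2 fun a ha => mul_ne_zero hA
      (pow_ne_zero _ (scaleFactor_ne_zero hc (hP x hx) (Finset.mem_sdiff.1 ha).1))
  refine ⟨(finsum_mem_eq_of_bijOn _ hbij fun x hx => ?_).symm, ?_, ?_⟩
  · rw [det_hessian_transport hcons hA hc hQ (hP x hx) hx,
      faddeevPopov_mul_parkeTaylor_transport hj hα hfix hA hc hQ (hP x hx), mul_pow,
      mul_div_mul_left _ _ (pow_ne_zero 2 (hJ x hx))]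
  · rw [IsRegular, IsRegular, hbij.finite_iff_finite]
    refine and_congr_right fun _ => ?_
    rw [← hbij.image_eq, Set.forall_mem_image]
    refine forall₂_congr fun x hx => ?_
    rw [det_hessian_transport hcons hA hc hQ (hP x hx) hx]
    exact ⟨fun h => mul_ne_zero (pow_ne_zero 2 (hJ x hx)) h, fun h => right_ne_zero_of_mul h⟩
  · rw [← hbij.image_eq, Set.image_nonempty]

end gauge

/-! ### Splitting -/

lemma consecutive_congr {α : List ℕ} {p q : ℕ → Fin 3 → ℂ} (h : ∀ a ∈ α.toFinset, p a = q a)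
    {i : ℕ} (hi : i ∈ Finset.range α.length) : consecutive α p i = consecutive α q i := by
  have h0 : 0 < α.length := (Nat.zero_le i).trans_lt (Finset.mem_range.1 hi)
  have hm : ∀ k, α.getD (k % α.length) 0 ∈ α.toFinset := fun k => by
    rw [List.getD_eq_getElem _ _ (Nat.mod_lt _ h0)]
    exact List.mem_toFinset.2 (List.getElem_mem _)
  rw [consecutive, consecutive, h _ (hm _), h _ (hm _), h _ (hm _)]

/-- `∑ₓ∑ᵧ f(x) g(y)` factorizes, also when the supports are infinite. -/
lemma finsum_prod_mul {X Y : Type*} (f : X → ℂ) (g : Y → ℂ) :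
    ∑ᶠ p : X × Y, f p.1 * g p.2 = (∑ᶠ x, f x) * ∑ᶠ y, g y := by
  have hsupp : (Function.support fun p : X × Y => f p.1 * g p.2) =
      Function.support f ×ˢ Function.support g := by
    ext p; simp
  by_cases hfin : (Function.support fun p : X × Y => f p.1 * g p.2).Finite
  · rw [finsum_curry _ hfin, finsum_mul]
    simp only [mul_finsum]
  -- An infinite product of supports has an infinite factor, so both sides take the default value
  -- zero.
  · rw [finsum_of_infinite_support hfin]
    rw [hsupp, ← Set.Infinite, Set.infinite_prod] at hfin
    rcases hfin with h | h
    · rw [finsum_of_infinite_support h.1, zero_mul]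
    · rw [finsum_of_infinite_support h.1, mul_zero]

section splitting

variable {j : ℕ} {α α' β : List ℕ} {s : Finset ℕ → ℂ} {P : ℕ → Fin 3 → ℂ}

/-- The variables of an ordering of a subset of the labels. -/
def varIncl (h : α.toFinset ⊆ β.toFinset) (k : Var j α) : Var j β :=
  (⟨k.1, Finset.sdiff_subset_sdiff h subset_rfl k.1.2⟩, k.2)

lemma varIncl_injective (h : α.toFinset ⊆ β.toFinset) :
    Function.Injective (varIncl (j := j) h) := by
  rintro ⟨⟨a, ha⟩, t⟩ ⟨⟨b, hb⟩, u⟩ hab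
  obtain rfl : a = b := congrArg (fun m : Var j β => (m.1 : ℕ)) hab
  obtain rfl : t = u := congrArg Prod.snd hab
  rfl

lemma puncture_comp_varIncl (h : α.toFinset ⊆ β.toFinset) (x : Var j β → ℂ) {a : ℕ}
    (ha : a ∈ α.toFinset) :
    puncture j α P (x ∘ varIncl h) a = puncture j β P x a := by
  by_cases hf : a ∈ freeLabels j α
  · rw [puncture_of_mem hf, puncture_of_mem (Finset.sdiff_subset_sdiff h subset_rfl hf)]
    rfl
  · rw [puncture_of_notMem hf, puncture_of_notMem
      (notMem_freeLabels_of_mem_fixedLabels (mem_fixedLabels_of_notMem_freeLabels ha hf))]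

lemma puncture_update_of_ne (x : Var j β → ℂ) (k : Var j β) (z : ℂ) {a : ℕ} (ha : a ≠ k.1) :
    puncture j β P (Function.update x k z) a = puncture j β P x a := by
  by_cases hf : a ∈ freeLabels j β
  · have h : ∀ t : Fin 2, (⟨⟨a, hf⟩, t⟩ : Var j β) ≠ k := by
      rintro t rfl; exact ha rfl
    rw [puncture_of_mem hf, puncture_of_mem hf, Function.update_of_ne (h 0),
      Function.update_of_ne (h 1)]
  · rw [puncture_of_notMem hf, puncture_of_notMem hf]

/-- A contributing bracket not contained in `α` has no free label of `α`, so it is constant in the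
variable `k`. -/
lemma dPotential_varIncl (h : α.toFinset ⊆ β.toFinset)
    (hs : ∀ J ∈ β.toFinset.powersetCard 3, s J ≠ 0 →
      J ⊆ α.toFinset ∨ Disjoint J (freeLabels j α)) (x : Var j β → ℂ) (k : Var j α) :
    dPotential j s β P x (varIncl h k) = dPotential j s α P (x ∘ varIncl h) k := by
  rw [dPotential, dPotential, ← Finset.sum_subset (Finset.powersetCard_mono h)]
  · refine Finset.sum_congr rfl fun J hJ => ?_
    obtain ⟨h1, h2⟩ := Finset.mem_powersetCard.1 hJ
    congr 2
    funext z
    refine plucker_congr h2 fun a ha => ?_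
    rw [← puncture_comp_varIncl h _ (h1 ha),
      Function.update_comp_eq_of_injective _ (varIncl_injective h)]
  · intro J hJ hJα
    have h2 := (Finset.mem_powersetCard.1 hJ).2
    by_cases hsJ : s J = 0
    · rw [hsJ, zero_mul]
    have hd : Disjoint J (freeLabels j α) :=
      (hs J hJ hsJ).resolve_left fun h1 => hJα (Finset.mem_powersetCard.2 ⟨h1, h2⟩)
    have hc : (fun z => plucker (puncture j β P (Function.update x (varIncl h k) z)) J) =
        fun _ => plucker (puncture j β P x) J := by
      funext z
      refine plucker_congr h2 fun a ha => puncture_update_of_ne _ _ _ ?_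
      rintro rfl
      exact Finset.disjoint_left.1 hd ha k.1.2
    rw [hc, logDeriv_const, Pi.zero_apply, mul_zero]

/-- The ordering `β` splits into the orderings `α` and `α'`, which share only the labels of the
gauge-fixed punctures and between which there are no nonzero kinematic invariants. -/
structure Splits (j : ℕ) (s : Finset ℕ → ℂ) (β α α' : List ℕ) : Prop where
  subset_left : α.toFinset ⊆ β.toFinset
  subset_right : α'.toFinset ⊆ β.toFinset
  cover : β.toFinset ⊆ α.toFinset ∪ α'.toFinset
  inter_subset : α.toFinset ∩ α'.toFinset ⊆ fixedLabels j
  kinematics : ∀ J ∈ β.toFinset.powersetCard 3, s J ≠ 0 → J ⊆ α.toFinset ∨ J ⊆ α'.toFinset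
  prod_consecutive : ∀ p : ℕ → Fin 3 → ℂ,
    (∏ i ∈ Finset.range α.length, consecutive α p i) *
      (∏ i ∈ Finset.range α'.length, consecutive α' p i) =
    (∏ i ∈ Finset.range β.length, consecutive β p i) * faddeevPopov j p

/-! ### Separation of variables for a split ordering -/

namespace Splits

variable (H : Splits j s β α α')
include H

lemma symm : Splits j s β α' α where
  subset_left := H.subset_right
  subset_right := H.subset_left
  cover := by rw [Finset.union_comm]; exact H.cover
  inter_subset := by rw [Finset.inter_comm]; exact H.inter_subset
  kinematics := fun J hJ hs => (H.kinematics J hJ hs).symm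
  prod_consecutive := fun p => by rw [mul_comm]; exact H.prod_consecutive p

lemma dPotential_left (x : Var j β → ℂ) (k : Var j α) :
    dPotential j s β P x (varIncl H.subset_left k) =
      dPotential j s α P (x ∘ varIncl H.subset_left) k := by
  refine dPotential_varIncl _ (fun J hJ hs => (H.kinematics J hJ hs).imp_right fun h => ?_) x k
  refine Finset.disjoint_left.2 fun a ha ha' => ?_
  obtain ⟨h1, h2⟩ := Finset.mem_sdiff.1 ha'
  exact h2 (H.inter_subset (Finset.mem_inter.2 ⟨h1, h ha⟩))

lemma varIncl_ne (k : Var j α) (l : Var j α') :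
    varIncl H.subset_left k ≠ varIncl H.subset_right l := by
  intro h
  have h1 : (k.1 : ℕ) = l.1 := congrArg (fun m : Var j β => (m.1 : ℕ)) h
  obtain ⟨h2, h3⟩ := Finset.mem_sdiff.1 k.1.2
  exact h3 (H.inter_subset (Finset.mem_inter.2 ⟨h2, h1 ▸ (Finset.mem_sdiff.1 l.1.2).1⟩))

lemma hessian_left (x : Var j β → ℂ) (k l : Var j α) :
    hessian j s β P x (varIncl H.subset_left k) (varIncl H.subset_left l) =
      hessian j s α P (x ∘ varIncl H.subset_left) k l := by
  simp only [hessian, Matrix.of_apply, H.dPotential_left,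
    Function.update_comp_eq_of_injective _ (varIncl_injective H.subset_left)]
  rfl

/-- The left scattering equations do not involve the right variables. -/
lemma hessian_left_right (x : Var j β → ℂ) (k : Var j α) (l : Var j α') :
    hessian j s β P x (varIncl H.subset_left k) (varIncl H.subset_right l) = 0 := by
  have h : ∀ z, Function.update x (varIncl H.subset_right l) z ∘ varIncl H.subset_left =
      x ∘ varIncl H.subset_left := fun z =>
    Function.update_comp_eq_of_forall_ne _ _ fun k => H.varIncl_ne k l
  simp only [hessian, Matrix.of_apply, H.dPotential_left, h, deriv_const]

/-- The variables of `β` are those of `α` together with those of `α'`. -/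
noncomputable def varEquiv : Var j α ⊕ Var j α' ≃ Var j β :=
  Equiv.ofBijective (Sum.elim (varIncl H.subset_left) (varIncl H.subset_right)) <| by
    refine ⟨(varIncl_injective _).sumElim (varIncl_injective _) H.varIncl_ne, ?_⟩
    rintro ⟨⟨a, ha⟩, t⟩
    obtain ⟨h1, h2⟩ := Finset.mem_sdiff.1 ha
    rcases Finset.mem_union.1 (H.cover h1) with h | h
    · exact ⟨Sum.inl (⟨a, Finset.mem_sdiff.2 ⟨h, h2⟩⟩, t), rfl⟩
    · exact ⟨Sum.inr (⟨a, Finset.mem_sdiff.2 ⟨h, h2⟩⟩, t), rfl⟩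

lemma det_hessian (x : Var j β → ℂ) :
    (hessian j s β P x).det = (hessian j s α P (x ∘ varIncl H.subset_left)).det *
      (hessian j s α' P (x ∘ varIncl H.subset_right)).det := by
  rw [← Matrix.det_submatrix_equiv_self H.varEquiv, ← Matrix.det_fromBlocks_zero₁₂ _ 0]
  congr 1
  ext (k | k) (l | l)
  · exact H.hessian_left x k l
  · exact H.hessian_left_right x k l
  · exact H.symm.hessian_left_right x k l
  · exact H.symm.hessian_left x k l

lemma prod_consecutive_left (x : Var j β → ℂ) :
    ∏ i ∈ Finset.range α.length,
      consecutive α (puncture j α P (x ∘ varIncl H.subset_left)) i =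
    ∏ i ∈ Finset.range α.length, consecutive α (puncture j β P x) i :=
  Finset.prod_congr rfl fun _ hi =>
    consecutive_congr (fun _ ha => puncture_comp_varIncl H.subset_left x ha) hi

omit H in
lemma faddeevPopov_puncture (x : Var j β → ℂ) :
    faddeevPopov j (puncture j β P x) = faddeevPopov j P := by
  have h : ∀ a ∈ fixedLabels j, puncture j β P x a = P a := fun a ha =>
    puncture_of_notMem (notMem_freeLabels_of_mem_fixedLabels ha) x
  simp only [faddeevPopov, h 1 (by simp [fixedLabels]), h 2 (by simp [fixedLabels]),
    h j (by simp [fixedLabels]), h (j + 1) (by simp [fixedLabels])]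

lemma faddeevPopov_mul_parkeTaylor (hV : faddeevPopov j P ≠ 0) (x : Var j β → ℂ) :
    faddeevPopov j (puncture j β P x) * parkeTaylor β (puncture j β P x) =
      (faddeevPopov j (puncture j α P (x ∘ varIncl H.subset_left)) *
        parkeTaylor α (puncture j α P (x ∘ varIncl H.subset_left))) *
      (faddeevPopov j (puncture j α' P (x ∘ varIncl H.subset_right)) *
        parkeTaylor α' (puncture j α' P (x ∘ varIncl H.subset_right))) := by
  have h := H.prod_consecutive (puncture j β P x)
  simp only [faddeevPopov_puncture] at h ⊢
  rw [parkeTaylor, parkeTaylor, parkeTaylor, H.prod_consecutive_left, H.symm.prod_consecutive_left,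
    mul_mul_mul_comm, div_mul_div_comm, h]
  generalize ∏ i ∈ Finset.range β.length, consecutive β (puncture j β P x) i = C
  by_cases hC : C = 0
  · simp [hC]
  · field_simp

/-- The parts carry extra consecutive brackets, those of `V`. These depend only on the gauge, so
`hV` makes the nonvanishing conditions agree. -/
lemma mem_solutions_iff (hV : faddeevPopov j P ≠ 0) (x : Var j β → ℂ) :
    x ∈ solutions j s β P ↔ x ∘ varIncl H.subset_left ∈ solutions j s α P ∧
      x ∘ varIncl H.subset_right ∈ solutions j s α' P := by
  have hd : (∀ k, dPotential j s β P x k = 0) ↔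
      (∀ k, dPotential j s α P (x ∘ varIncl H.subset_left) k = 0) ∧
      ∀ k, dPotential j s α' P (x ∘ varIncl H.subset_right) k = 0 := by
    rw [← H.varEquiv.forall_congr_right, Sum.forall]
    refine and_congr (forall_congr' fun k => ?_) (forall_congr' fun k => ?_)
    · rw [← H.dPotential_left]; rfl
    · rw [← H.symm.dPotential_left]; rfl
  have hc := H.prod_consecutive (puncture j β P x)
  rw [faddeevPopov_puncture] at hc
  have hC : ∏ i ∈ Finset.range β.length, consecutive β (puncture j β P x) i ≠ 0 ↔
      ∏ i ∈ Finset.range α.length,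
        consecutive α (puncture j α P (x ∘ varIncl H.subset_left)) i ≠ 0 ∧
      ∏ i ∈ Finset.range α'.length,
        consecutive α' (puncture j α' P (x ∘ varIncl H.subset_right)) i ≠ 0 := by
    rw [H.prod_consecutive_left, H.symm.prod_consecutive_left, ← mul_ne_zero_iff, hc,
      mul_ne_zero_iff, and_iff_left hV]
  have hpl : (∀ J ∈ β.toFinset.powersetCard 3, s J ≠ 0 → plucker (puncture j β P x) J ≠ 0) ↔
      (∀ J ∈ α.toFinset.powersetCard 3, s J ≠ 0 →
        plucker (puncture j α P (x ∘ varIncl H.subset_left)) J ≠ 0) ∧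
      (∀ J ∈ α'.toFinset.powersetCard 3, s J ≠ 0 →
        plucker (puncture j α' P (x ∘ varIncl H.subset_right)) J ≠ 0) := by
    have e : ∀ {γ : List ℕ} (hγ : γ.toFinset ⊆ β.toFinset), ∀ J ∈ γ.toFinset.powersetCard 3,
        plucker (puncture j γ P (x ∘ varIncl hγ)) J = plucker (puncture j β P x) J :=
      fun hγ J hJ => plucker_congr (Finset.mem_powersetCard.1 hJ).2 fun a ha =>
        puncture_comp_varIncl hγ x ((Finset.mem_powersetCard.1 hJ).1 ha)
    constructor
    · refine fun h => ⟨fun J hJ hs => ?_, fun J hJ hs => ?_⟩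
      · rw [e _ J hJ]; exact h J (Finset.powersetCard_mono H.subset_left hJ) hs
      · rw [e _ J hJ]; exact h J (Finset.powersetCard_mono H.subset_right hJ) hs
    · rintro ⟨h1, h2⟩ J hJ hs
      have hcard := (Finset.mem_powersetCard.1 hJ).2
      rcases H.kinematics J hJ hs with h | h
      · have hJ' := Finset.mem_powersetCard.2 ⟨h, hcard⟩
        rw [← e H.subset_left J hJ']; exact h1 J hJ' hs
      · have hJ' := Finset.mem_powersetCard.2 ⟨h, hcard⟩
        rw [← e H.subset_right J hJ']; exact h2 J hJ' hs
  rw [CEGM.mem_solutions_iff, CEGM.mem_solutions_iff, CEGM.mem_solutions_iff,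
    ← forall_dPotential_eq_zero_iff, ← forall_dPotential_eq_zero_iff,
    ← forall_dPotential_eq_zero_iff, hpl, hC, hd]
  exact ⟨fun ⟨⟨a, a'⟩, ⟨b, b'⟩, c, c'⟩ => ⟨⟨a, b, c⟩, a', b', c'⟩,
    fun ⟨⟨a, b, c⟩, a', b', c'⟩ => ⟨⟨a, a'⟩, ⟨b, b'⟩, c, c'⟩⟩

/-- The configurations of `β` are pairs of configurations of `α` and `α'`. -/
noncomputable def configEquiv : (Var j β → ℂ) ≃ (Var j α → ℂ) × (Var j α' → ℂ) :=
  (Equiv.arrowCongr H.varEquiv.symm (Equiv.refl ℂ)).trans (Equiv.sumArrowEquivProdArrow _ _ _)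

lemma configEquiv_apply (x : Var j β → ℂ) :
    H.configEquiv x = (x ∘ varIncl H.subset_left, x ∘ varIncl H.subset_right) := rfl

lemma solutions_eq (hV : faddeevPopov j P ≠ 0) :
    solutions j s β P = H.configEquiv ⁻¹' (solutions j s α P ×ˢ solutions j s α' P) := by
  ext x
  rw [H.mem_solutions_iff hV, Set.mem_preimage, configEquiv_apply, Set.mem_prod]

theorem integral_eq (hV : faddeevPopov j P ≠ 0) :
    integral j s β P = integral j s α P * integral j s α' P := by
  rw [integral, integral, integral, finsum_mem_def, finsum_mem_def, finsum_mem_def,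
    ← finsum_prod_mul]
  refine finsum_eq_of_bijective H.configEquiv H.configEquiv.bijective fun x => ?_
  rw [configEquiv_apply]
  classical
  -- Sums over solution sets become sums of indicators over all configurations, so the comparison is
  -- pointwise and needs no finiteness.
  simp only [Set.indicator_apply, H.mem_solutions_iff hV, ite_and]
  split_ifs
  · rw [H.det_hessian, H.faddeevPopov_mul_parkeTaylor hV, mul_pow, mul_div_mul_comm]
  all_goals simp

theorem isRegular (hV : faddeevPopov j P ≠ 0) (h1 : IsRegular j s α P)
    (h2 : IsRegular j s α' P) : IsRegular j s β P := by
  refine ⟨?_, fun x hx => ?_⟩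
  · rw [H.solutions_eq hV]
    exact (h1.1.prod h2.1).preimage H.configEquiv.injective.injOn
  · obtain ⟨hx1, hx2⟩ := (H.mem_solutions_iff hV x).1 hx
    rw [H.det_hessian]
    exact mul_ne_zero (h1.2 _ hx1) (h2.2 _ hx2)

/-- Every left solution extends to a full one by the right half of `x₀`. Without any solution,
regularity of `β` would be vacuous. -/
theorem isRegular_left (hV : faddeevPopov j P ≠ 0) (h : IsRegular j s β P)
    (hne : (solutions j s β P).Nonempty) : IsRegular j s α P := by
  obtain ⟨x₀, hx₀⟩ := hne
  have hx₀' := ((H.mem_solutions_iff hV x₀).1 hx₀).2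
  have key : ∀ y ∈ solutions j s α P,
      ∃ x ∈ solutions j s β P, x ∘ varIncl H.subset_left = y := fun y hy => by
    obtain ⟨x, hx⟩ := H.configEquiv.surjective (y, x₀ ∘ varIncl H.subset_right)
    rw [configEquiv_apply, Prod.mk.injEq] at hx
    refine ⟨x, (H.mem_solutions_iff hV x).2 ?_, hx.1⟩
    rw [hx.1, hx.2]
    exact ⟨hy, hx₀'⟩
  refine ⟨(h.1.image fun x => x ∘ varIncl H.subset_left).subset key, fun y hy => ?_⟩
  obtain ⟨x, hx, rfl⟩ := key y hy
  have := h.2 x hx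
  rw [H.det_hessian] at this
  exact left_ne_zero_of_mul this

end Splits

end splitting
/-! ### The orderings of the split kinematics -/

lemma toFinset_fullOrdering (n : ℕ) : (fullOrdering n).toFinset = Finset.Icc 1 n := by
  ext a
  simp only [fullOrdering, List.mem_toFinset, List.mem_range'_1, Finset.mem_Icc]
  omega

lemma toFinset_rightOrdering {n j : ℕ} (hjn : j + 1 ≤ n) :
    (rightOrdering n j).toFinset = Finset.Icc j n ∪ {1, 2} := by
  ext a
  simp only [rightOrdering, List.mem_toFinset, List.mem_append, List.mem_range'_1, Finset.mem_Icc,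
    Finset.mem_union, Finset.mem_insert, Finset.mem_singleton, List.mem_cons, List.not_mem_nil,
    or_false]
  omega

lemma leftOrdering_eq (j : ℕ) : leftOrdering j = fullOrdering (j + 1) := rfl

lemma prod_consecutive_fullOrdering (m : ℕ) (p : ℕ → Fin 3 → ℂ) :
    ∏ i ∈ Finset.range (fullOrdering (m + 2)).length, consecutive (fullOrdering (m + 2)) p i =
      (∏ i ∈ Finset.range m, bracket (p (i + 1)) (p (i + 2)) (p (i + 3))) *
        bracket (p (m + 1)) (p (m + 2)) (p 1) * bracket (p (m + 2)) (p 1) (p 2) := by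
  have hlen : (fullOrdering (m + 2)).length = m + 2 := by simp [fullOrdering]
  have hget : ∀ i < m + 2, (fullOrdering (m + 2)).getD i 0 = i + 1 := fun i hi => by
    rw [List.getD_eq_getElem _ _ (by rw [hlen]; exact hi)]
    simp [fullOrdering, add_comm]
  simp only [consecutive, hlen]
  rw [Finset.prod_range_succ, Finset.prod_range_succ]
  congr 1
  · congr 1
    · refine Finset.prod_congr rfl fun i hi => ?_
      have hi := Finset.mem_range.1 hi
      rw [Nat.mod_eq_of_lt (by omega), Nat.mod_eq_of_lt (by omega), Nat.mod_eq_of_lt (by omega),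
        hget _ (by omega), hget _ (by omega), hget _ (by omega)]
    · rw [Nat.mod_eq_of_lt (by omega), Nat.mod_eq_of_lt (by omega), Nat.mod_self,
        hget _ (by omega), hget _ (by omega), hget _ (by omega)]
  · rw [Nat.mod_eq_of_lt (by omega), Nat.mod_self, show m + 1 + 2 = (m + 2) + 1 by omega,
      Nat.add_mod_left, Nat.mod_eq_of_lt (by omega),
      hget _ (by omega), hget _ (by omega), hget _ (by omega)]

/-- With `n = j + 1 + m` there are `m + 2` labels from `j` to `n`, hence `m` inner windows; the
other four meet the appended `1, 2`. -/
lemma prod_consecutive_rightOrdering (j m : ℕ) (p : ℕ → Fin 3 → ℂ) :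
    ∏ i ∈ Finset.range (rightOrdering (j + 1 + m) j).length,
        consecutive (rightOrdering (j + 1 + m) j) p i =
      (∏ i ∈ Finset.range m, bracket (p (j + i)) (p (j + i + 1)) (p (j + i + 2))) *
        bracket (p (j + m)) (p (j + m + 1)) (p 1) * bracket (p (j + m + 1)) (p 1) (p 2) *
        bracket (p 1) (p 2) (p j) * bracket (p 2) (p j) (p (j + 1)) := by
  have e : rightOrdering (j + 1 + m) j = List.range' j (m + 2) ++ [1, 2] := by
    rw [rightOrdering, show j + 1 + m + 1 - j = m + 2 by omega]
  have hlen : (rightOrdering (j + 1 + m) j).length = m + 4 := by simp [e]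
  have hget : ∀ i < m + 2, (rightOrdering (j + 1 + m) j).getD i 0 = j + i := fun i hi => by
    rw [e, List.getD_append _ _ _ _ (by simpa using hi),
      List.getD_eq_getElem _ _ (by simpa using hi)]
    simp
  have hget1 : (rightOrdering (j + 1 + m) j).getD (m + 2) 0 = 1 := by
    rw [e, List.getD_append_right _ _ _ _ (by simp)]; simp
  have hget2 : (rightOrdering (j + 1 + m) j).getD (m + 2 + 1) 0 = 2 := by
    rw [e, List.getD_append_right _ _ _ _ (by simp)]; simp
  simp only [consecutive, hlen]
  rw [Finset.prod_range_succ, Finset.prod_range_succ, Finset.prod_range_succ,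
    Finset.prod_range_succ]
  congr 1
  · congr 1
    · congr 1
      · congr 1
        · refine Finset.prod_congr rfl fun i hi => ?_
          have hi := Finset.mem_range.1 hi
          rw [Nat.mod_eq_of_lt (by omega), Nat.mod_eq_of_lt (by omega),
            Nat.mod_eq_of_lt (by omega), hget _ (by omega), hget _ (by omega), hget _ (by omega)]
          rfl
        · rw [Nat.mod_eq_of_lt (by omega), Nat.mod_eq_of_lt (by omega),
            Nat.mod_eq_of_lt (by omega), hget _ (by omega), hget _ (by omega), hget1]
          rfl
      · rw [Nat.mod_eq_of_lt (by omega), Nat.mod_eq_of_lt (by omega),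
          Nat.mod_eq_of_lt (by omega), hget _ (by omega), hget1, hget2]
        rfl
    · rw [Nat.mod_eq_of_lt (by omega), Nat.mod_eq_of_lt (by omega), Nat.mod_self, hget1, hget2,
        hget _ (by omega)]
      rfl
  · rw [Nat.mod_eq_of_lt (by omega), Nat.mod_self, show m + 3 + 2 = (m + 4) + 1 by omega,
      Nat.add_mod_left, Nat.mod_eq_of_lt (by omega), hget2, hget _ (by omega), hget _ (by omega)]
    rfl

lemma splits_of_splitKinematics {n j : ℕ} (hj : 3 ≤ j) (hjn : j + 1 ≤ n) {s : Finset ℕ → ℂ}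
    (hsplit : SplitKinematics n j s) :
    Splits j s (fullOrdering n) (leftOrdering j) (rightOrdering n j) where
  subset_left := by
    rw [leftOrdering_eq, toFinset_fullOrdering, toFinset_fullOrdering]
    exact Finset.Icc_subset_Icc le_rfl hjn
  subset_right := by
    rw [toFinset_rightOrdering hjn, toFinset_fullOrdering]
    intro a
    simp only [Finset.mem_union, Finset.mem_Icc, Finset.mem_insert, Finset.mem_singleton]
    omega
  cover := by
    rw [leftOrdering_eq, toFinset_rightOrdering hjn, toFinset_fullOrdering, toFinset_fullOrdering]
    intro a
    simp only [Finset.mem_union, Finset.mem_Icc, Finset.mem_insert, Finset.mem_singleton]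
    omega
  inter_subset := by
    rw [leftOrdering_eq, toFinset_rightOrdering hjn, toFinset_fullOrdering]
    intro a
    simp only [Finset.mem_inter, Finset.mem_union, Finset.mem_Icc, Finset.mem_insert,
      Finset.mem_singleton, fixedLabels]
    omega
  kinematics := fun J hJ hs => by
    rw [leftOrdering_eq, toFinset_rightOrdering hjn, toFinset_fullOrdering]
    rw [toFinset_fullOrdering] at hJ
    by_contra h
    rw [not_or] at h
    exact hs (hsplit J hJ h.1 h.2)
  prod_consecutive := fun p => by
    obtain ⟨m, rfl⟩ := Nat.exists_eq_add_of_le hjn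
    obtain ⟨i, rfl⟩ := Nat.exists_eq_add_of_le hj
    -- Windows starting at `1, …, j - 1` come from the left, those at `j, …, n - 2` and the two
    -- closing ones from the right. The surplus, two brackets on each side, is `V`.
    rw [leftOrdering_eq, prod_consecutive_rightOrdering,
      show 3 + i + 1 + m = (i + 2 + m) + 2 by omega, prod_consecutive_fullOrdering,
      show 3 + i + 1 = (i + 2) + 2 by omega, prod_consecutive_fullOrdering, Finset.prod_range_add _ (i + 2) m,
      faddeevPopov]
    simp only [show i + 2 + 1 = 3 + i by omega, show i + 2 + 2 = 3 + i + 1 by omega,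
      show i + 2 + m + 1 = 3 + i + m by omega, show i + 2 + m + 2 = 3 + i + m + 1 by omega]
    have h : ∀ k, bracket (p (i + 2 + k + 1)) (p (i + 2 + k + 2)) (p (i + 2 + k + 3)) =
        bracket (p (3 + i + k)) (p (3 + i + k + 1)) (p (3 + i + k + 2)) := fun k => by
      rw [show i + 2 + k + 1 = 3 + i + k by omega, show i + 2 + k + 2 = 3 + i + k + 1 by omega,
        show i + 2 + k + 3 = 3 + i + k + 2 by omega]
    simp only [h]
    ring

lemma faddeevPopov_stdGauge_ne_zero {j : ℕ} (hj : 3 ≤ j) :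
    faddeevPopov j (stdGauge j) ≠ 0 := by
  have h1 : stdGauge j 1 = ![0, 0, 1] := by simp [stdGauge]
  have h2 : stdGauge j 2 = ![0, 1, 0] := by simp [stdGauge]
  have h3 : stdGauge j j = ![1, 0, 0] := by
    rw [stdGauge, if_neg (by omega), if_neg (by omega), if_pos rfl]
  have h4 : stdGauge j (j + 1) = ![1, 1, 1] := by
    rw [stdGauge, if_neg (by omega), if_neg (by omega), if_neg (by omega)]
  simp [faddeevPopov, h1, h2, h3, h4, bracket, Matrix.det_fin_three]

end CEGM

/-! ### Gauge change followed by splitting -/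

theorem mainTheorem7 (n j : ℕ) (hj : 3 ≤ j) (hjn : j + 1 ≤ n) (s : Finset ℕ → ℂ)
    (hcons : CEGM.MomentumConservation n s) (hsplit : CEGM.SplitKinematics n j s)
    (g : GL (Fin 3) ℂ) (P : ℕ → Fin 3 → ℂ) (hP : CEGM.IsGenericGauge n j s g P) :
    CEGM.amplitude n j s P =
        CEGM.integral j s (CEGM.leftOrdering j) (CEGM.stdGauge j) *
          CEGM.integral j s (CEGM.rightOrdering n j) (CEGM.stdGauge j) ∧
      (CEGM.IsRegular j s (CEGM.leftOrdering j) (CEGM.stdGauge j) →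
        CEGM.IsRegular j s (CEGM.rightOrdering n j) (CEGM.stdGauge j) →
        CEGM.IsRegular j s (CEGM.fullOrdering n) P) ∧
      (CEGM.IsRegular j s (CEGM.fullOrdering n) P →
        (CEGM.solutions j s (CEGM.fullOrdering n) P).Nonempty →
        CEGM.IsRegular j s (CEGM.leftOrdering j) (CEGM.stdGauge j) ∧
          CEGM.IsRegular j s (CEGM.rightOrdering n j) (CEGM.stdGauge j)) := by
  obtain ⟨hgauge, hstd, hinv⟩ := hP
  have hfix : CEGM.fixedLabels j ⊆ (CEGM.fullOrdering n).toFinset := by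
    rw [CEGM.toFinset_fullOrdering]
    intro a
    simp only [CEGM.fixedLabels, Finset.mem_insert, Finset.mem_singleton, Finset.mem_Icc]
    omega
  have hcons' : ∀ a ∈ (CEGM.fullOrdering n).toFinset,
      ∑ J ∈ ((CEGM.fullOrdering n).toFinset.powersetCard 3).filter (fun J => a ∈ J), s J = 0 := by
    rw [CEGM.toFinset_fullOrdering]
    exact hcons
  choose! c hc0 hc using hgauge
  obtain ⟨hint, hreg, hne⟩ := CEGM.integral_eq_and_isRegular_iff_of_gauge hj
    (List.nodup_range' ..) hfix hcons' (A := (g : Matrix (Fin 3) (Fin 3) ℂ))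
    (B := ((g⁻¹ : GL (Fin 3) ℂ) : Matrix (Fin 3) (Fin 3) ℂ)) (Units.inv_mul g) hc0 hc hstd hinv
  have H := CEGM.splits_of_splitKinematics hj hjn hsplit
  have hV := CEGM.faddeevPopov_stdGauge_ne_zero hj
  refine ⟨hint.trans (H.integral_eq hV), fun h1 h2 => hreg.2 (H.isRegular hV h1 h2),
    fun h h' => ?_⟩
  exact ⟨H.isRegular_left hV (hreg.1 h) (hne.1 h'), H.symm.isRegular_left hV (hreg.1 h) (hne.1 h')⟩
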